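/- Let $k$ be a field, $M$ a matroid on $[n]=\{1,\dots,n\}$ with dual matroid $M^\perp$, and $W\subseteq k^{n}$ a linear realization of $M$: a linear subspace such that, for $B\subseteq[n]$, the coordinate projection $W\to k^{B}$ is an isomorphism if and only if $B$ is a basis of $M$. Let $W^\perp=\{q\in k^n:\sum_i p_iq_i=0\text{ for all }p\in W\}$, let $S=k[W\times W^\perp]=k[W]\otimes_k k[W^\perp]=\operatorname{Sym}\big((W\times W^\perp)^*\big)$ (a polynomial ring in $n$ variables), and let $f_i,g_i\in S$ be the linear forms $f_i(p,q)=p_i$ and $g_i(p,q)=q_i$. Let $\mathfrak a=(f_1g_1,\dots,f_ng_n)\subseteq S$ be the ideal of pairs. For $I,J\subseteq[n]$ put $\mathfrak p_{I,J}=(f_i: i\in I)+(g_j: j\in J)$ and let $L_{I,J}=V(\mathfrak p_{I,J})$, whose $k$-points are the linear subspace $\{(p,q)\in W\times W^\perp: p_i=0\ (i\in I),\ q_j=0\ (j\in J)\}$. A biflat is a pair $(F,G)$ with $F$ a flat of $M$, $G$ a flat of $M^\perp$ and $F\cup G=[n]$. A flat of $M$ is cyclic if it is a union of circuits of $M$.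 Write $F^c=[n]\setminus F$. (a) Every associated prime of $S/\mathfrak a$ is equal to $\mathfrak p_{F,G}$ for some biflat $(F,G)$. (b) The set of minimal primes of $S/\mathfrak a$ (that is, of primes of $S$ minimal over $\mathfrak a$) is $\{\mathfrak p_{F,F^c}: F\text{ a cyclic flat of }M\}$. In particular, $V(\mathfrak a)=\bigcup_{F} L_{F,F^c}$, the union being over the cyclic flats $F$ of $M$; this holds both in $\operatorname{Spec}S$ and on $k$-points, i.e. as subsets of $W\times W^\perp$. (c) The ideal $\mathfrak a$ has a minimal (irredundant) primary decomposition, and for every cyclic flat $F$ of $M$, in every minimal primary decomposition of $\mathfrak a$, the primary component whose radical is $\mathfrak p_{F,F^c}$ occurs and is $\mathfrak p_{F,F^c}$ itself. -/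

import Mathlib

namespace IdealOfPairs

noncomputable section

variable {k : Type*} [Field k] {n : ℕ}

/-- `W` is a linear realization of the matroid `M` on the ground set `[n]`: the composite
`W → k^[n] → k^B` is an isomorphism if and only if `B` is a basis of `M`. -/
structure Realizes (W : Submodule k (Fin n → k)) (M : Matroid (Fin n)) : Prop where
  ground_eq : M.E = Set.univ
  isBase_iff : ∀ B : Set (Fin n),
    M.IsBase B ↔ Function.Bijective (fun (w : W) (b : B) => (w : Fin n → k) b)

/-- `W^⊥ = (k^[n] / W)^*`, the annihilator of `W`, viewed inside `k^[n]` through the standard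
identification of `k^[n]` with its dual. -/
def perp (W : Submodule k (Fin n → k)) : Submodule k (Fin n → k) where
  carrier := {q | ∀ p ∈ W, ∑ i, p i * q i = 0}
  add_mem' := by
    intro a b ha hb p hp
    simp [mul_add, Finset.sum_add_distrib, ha p hp, hb p hp]
  zero_mem' := by
    intro p _
    simp
  smul_mem' := by
    intro c q hq p hp
    have h := hq p hp
    have : ∑ i, p i * (c • q) i = c * ∑ i, p i * q i := by
      rw [Finset.mul_sum]
      exact Finset.sum_congr rfl fun i _ => by simp [mul_left_comm]
    rw [this, h, mul_zero]

/-- The coordinate ring `S = k[W] ⊗ k[W^⊥] = k[W × W^⊥]`, that is, the symmetric algebra of the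
dual space of `W × W^⊥`. It is a polynomial ring in `n` variables over `k`. -/
abbrev CoordRing (W : Submodule k (Fin n → k)) : Type _ :=
  SymmetricAlgebra k (Module.Dual k (W × perp W))

/-- The linear functional `(p, q) ↦ p i` on `W × W^⊥`. -/
def fstCoord (W : Submodule k (Fin n → k)) (i : Fin n) : Module.Dual k (W × perp W) :=
  LinearMap.proj i ∘ₗ W.subtype ∘ₗ LinearMap.fst k W (perp W)

/-- The linear functional `(p, q) ↦ q i` on `W × W^⊥`. -/
def sndCoord (W : Submodule k (Fin n → k)) (i : Fin n) : Module.Dual k (W × perp W) :=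
  LinearMap.proj i ∘ₗ (perp W).subtype ∘ₗ LinearMap.snd k W (perp W)

/-- `f_i ∈ S`, the restriction to `W` of the `i`-th coordinate function. -/
def f (W : Submodule k (Fin n → k)) (i : Fin n) : CoordRing W :=
  SymmetricAlgebra.ι k _ (fstCoord W i)

/-- `g_i ∈ S`, the restriction to `W^⊥` of the `i`-th coordinate function. -/
def g (W : Submodule k (Fin n → k)) (i : Fin n) : CoordRing W :=
  SymmetricAlgebra.ι k _ (sndCoord W i)

/-- The ideal of pairs `(f_1 g_1, …, f_n g_n)`. -/
def pairs (W : Submodule k (Fin n → k)) : Ideal (CoordRing W) :=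
  Ideal.span (Set.range fun i => f W i * g W i)

/-- The linear ideal `p_{I,J} = (f_i : i ∈ I) + (g_j : j ∈ J)`. -/
def linIdeal (W : Submodule k (Fin n → k)) (I J : Set (Fin n)) : Ideal (CoordRing W) :=
  Ideal.span (f W '' I) ⊔ Ideal.span (g W '' J)

/-- A biflat of `M`: a flat `F` of `M` and a flat `G` of the dual matroid with `F ∪ G = [n]`. -/
structure IsBiflat (M : Matroid (Fin n)) (F G : Set (Fin n)) : Prop where
  isFlat_left : M.IsFlat F
  isFlat_right : M✶.IsFlat G
  union_eq : F ∪ G = Set.univ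

/-- A cyclic flat of `M`: a flat that is a union of circuits. -/
structure IsCyclicFlat (M : Matroid (Fin n)) (F : Set (Fin n)) : Prop where
  isFlat : M.IsFlat F
  union_circuits : ∃ 𝒞 : Set (Set (Fin n)), (∀ C ∈ 𝒞, M.IsCircuit C) ∧ F = ⋃₀ 𝒞

/-- Evaluation of an element of `S` at a point of `W × W^⊥`. -/
def evalAt (W : Submodule k (Fin n → k)) (x : W × perp W) : CoordRing W →ₐ[k] k :=
  SymmetricAlgebra.lift (Module.Dual.eval k (W × perp W) x)

/-- The `k`-points of `V(𝔟)` in the affine space `W × W^⊥`. -/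
def pointLocus (W : Submodule k (Fin n → k)) (𝔟 : Ideal (CoordRing W)) : Set (W × perp W) :=
  {x | ∀ s ∈ 𝔟, evalAt W x s = 0}

/-- The linear subspace `L_{I,J}` of `W × W^⊥` given by `p i = 0` for `i ∈ I` and `q j = 0` for
`j ∈ J`. -/
def linSubspace (W : Submodule k (Fin n → k)) (I J : Set (Fin n)) : Submodule k (W × perp W) :=
  (⨅ i ∈ I, LinearMap.ker (fstCoord W i)) ⊓ (⨅ j ∈ J, LinearMap.ker (sndCoord W j))

/-- `L_{I,J}` is the zero locus of `p_{I,J}`. -/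
theorem pointLocus_linIdeal (W : Submodule k (Fin n → k)) (I J : Set (Fin n)) :
    pointLocus W (linIdeal W I J) = linSubspace W I J := by
  ext x
  have key : x ∈ pointLocus W (linIdeal W I J) ↔
      linIdeal W I J ≤ RingHom.ker (evalAt W x) := Iff.rfl
  rw [key, linIdeal, sup_le_iff, Ideal.span_le, Ideal.span_le]
  simp [Set.subset_def, linSubspace, f, g, evalAt, RingHom.mem_ker]

end

end IdealOfPairs

namespace IdealOfPairs

/-! ### Linear ideals and colon ideals in a symmetric algebra -/

section SymmetricAlgebra

open MvPolynomial

variable {k : Type*} [Field k]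

/-! Let `P` be a prime containing the ideal of pairs, and let `I`, `J` index the `f i` and `g j` in
`P`; primality gives `I ∪ J = [n]`. Away from `P` the other forms are units, so `pairs W` becomes
the ideal generated by `localGens W I J`, whose elements are polynomials in the span `U` of the
forms indexed by `I` and `J`.

If `P` is associated, it is a colon ideal of `span (localGens W I J)`. That ideal is extended from
`Sym U`, and nonzero polynomials in variables complementary to `U` are nonzerodivisors modulo it;
since `P ⊇ U`, `P` is generated by `U` (`colon_eq_span_ι`). Matroid closure is linear span of
coordinate forms (`mem_closure_iff`), so `I` and `J` are flats.

If `P` is minimal, it equals both `p_{I, Iᶜ}` and `p_{Jᶜ, J}`. An `e` in `I ∩ J` would then lie in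
the closure of `Jᶜ` and in the dual closure of `Iᶜ`, against `notMem_closure_dual`. So `J = Iᶜ`,
which makes `I` a cyclic flat. There `localGens` already generates the linear ideal, so the primary
component is the prime itself. -/

theorem eq_zero_of_map_mul_mem_map_C {R τ : Type*} [CommRing R] [Algebra k R] {𝔟 : Ideal R}
    {t : MvPolynomial τ k} {x : MvPolynomial τ R}
    (hx : x ∉ 𝔟.map (C : R →+* MvPolynomial τ R))
    (h : map (algebraMap k R) t * x ∈ 𝔟.map (C : R →+* MvPolynomial τ R)) : t = 0 := by
  classical
  rw [mem_map_C_iff] at h hx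
  push Not at hx
  obtain ⟨m, hm⟩ := hx
  -- A functional killing `𝔟` but not one coefficient of `x`, applied coefficientwise, turns `x`
  -- into a nonzero `y` over the field `k` with `t * y = 0`.
  obtain ⟨φ, hφm, hφ⟩ := Submodule.exists_le_ker_of_notMem
    (p := 𝔟.restrictScalars k) (v := coeff m x) hm
  let y : MvPolynomial τ k := ∑ m ∈ x.support, monomial m (φ (coeff m x))
  have hy : ∀ a, coeff a y = φ (coeff a x) := by
    intro a
    simp only [y, coeff_sum, coeff_monomial, Finset.sum_ite_eq', mem_support_iff]
    split_ifs with ha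
    · rfl
    · simp [not_not.mp ha]
  have hty : t * y = 0 := by
    ext a
    have h0 : φ (coeff a (map (algebraMap k R) t * x)) = 0 := hφ (h a)
    rw [coeff_mul, map_sum] at h0
    rw [coeff_mul, coeff_zero, ← h0]
    refine Finset.sum_congr rfl fun z _ => ?_
    rw [hy, coeff_map, ← Algebra.smul_def, map_smul, smul_eq_mul]
  refine (mul_eq_zero.mp hty).resolve_right fun h0 => hφm ?_
  rw [← hy, h0, coeff_zero]

universe u

variable {E : Type u} [AddCommGroup E] [Module k E]

theorem exists_basis_sum (U : Submodule k E) :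
    ∃ (τ σ : Type u) (b : Module.Basis (τ ⊕ σ) k E),
      U = Submodule.span k (Set.range (b ∘ Sum.inr)) := by
  obtain ⟨V, hV⟩ := U.exists_isCompl
  let bU := Module.Basis.ofVectorSpace k U
  let bV := Module.Basis.ofVectorSpace k V
  refine ⟨_, _, (bV.prod bU).map (Submodule.prodEquivOfIsCompl V U hV.symm), ?_⟩
  have : ((bV.prod bU).map (Submodule.prodEquivOfIsCompl V U hV.symm)) ∘ Sum.inr =
      U.subtype ∘ bU := by
    ext i
    simp
  rw [this, Set.range_comp, ← Submodule.map_span, bU.span_eq, Submodule.map_top,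
    Submodule.range_subtype]

theorem span_ι_span (A : Set E) :
    Ideal.span (SymmetricAlgebra.ι k E '' (Submodule.span k A : Set E)) =
      Ideal.span (SymmetricAlgebra.ι k E '' A) := by
  refine le_antisymm (Ideal.span_le.mpr ?_)
    (Ideal.span_mono (Set.image_mono Submodule.subset_span))
  rintro _ ⟨u, hu, rfl⟩
  have : Submodule.span k A ≤ ((Ideal.span (SymmetricAlgebra.ι k E '' A)).restrictScalars k).comap
      (SymmetricAlgebra.ι k E) :=
    Submodule.span_le.mpr fun a ha => Ideal.subset_span ⟨a, ha, rfl⟩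
  exact this hu

variable {τ σ : Type*} (b : Module.Basis (τ ⊕ σ) k E)

/-- The map from the symmetric algebra to a polynomial ring which sends the second half of a basis
to zero. -/
noncomputable def killInr : SymmetricAlgebra k E →ₐ[k] MvPolynomial τ k :=
  SymmetricAlgebra.lift (b.constr k (Sum.elim X 0))

/-- The section of `killInr`. -/
noncomputable def sectionInl : MvPolynomial τ k →ₐ[k] SymmetricAlgebra k E :=
  aeval fun i => SymmetricAlgebra.ι k E (b (Sum.inl i))

theorem sub_section_killInr_mem (s : SymmetricAlgebra k E) :
    s - sectionInl b (killInr b s) ∈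
      Ideal.span (SymmetricAlgebra.ι k E '' (Set.range (b ∘ Sum.inr))) := by
  set 𝔭 := Ideal.span (SymmetricAlgebra.ι k E '' (Set.range (b ∘ Sum.inr)))
  have h : (Ideal.Quotient.mkₐ k 𝔭) =
      (Ideal.Quotient.mkₐ k 𝔭).comp ((sectionInl b).comp (killInr b)) := by
    refine SymmetricAlgebra.algHom_ext (b.ext ?_)
    rintro (i | i)
    · simp [killInr, sectionInl]
    · have h0 : killInr b (SymmetricAlgebra.ι k E (b (Sum.inr i))) = 0 := by simp [killInr]
      change Ideal.Quotient.mk 𝔭 _ = Ideal.Quotient.mk 𝔭 (sectionInl b (killInr b _))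
      rw [h0, map_zero, map_zero]
      exact Ideal.Quotient.eq_zero_iff_mem.mpr (Ideal.subset_span ⟨_, ⟨i, rfl⟩, rfl⟩)
  exact (Ideal.Quotient.mk_eq_mk_iff_sub_mem _ _).mp (DFunLike.congr_fun h s)

theorem ker_killInr : RingHom.ker (killInr b) =
    Ideal.span (SymmetricAlgebra.ι k E '' (Set.range (b ∘ Sum.inr))) := by
  refine le_antisymm (fun s hs => ?_) (Ideal.span_le.mpr ?_)
  · have := sub_section_killInr_mem b s
    rwa [(RingHom.mem_ker).mp hs, map_zero, sub_zero] at this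
  · rintro _ ⟨_, ⟨i, rfl⟩, rfl⟩
    simp [RingHom.mem_ker, killInr]

/-- In a basis adapted to the span of `A`, the ideal is the kernel of a map to a polynomial ring, a
domain. -/
theorem isPrime_span_ι (A : Set E) :
    (Ideal.span (SymmetricAlgebra.ι k E '' A)).IsPrime := by
  obtain ⟨τ, σ, b, hb⟩ := exists_basis_sum (Submodule.span k A)
  rw [← span_ι_span, hb, span_ι_span, ← ker_killInr]
  exact RingHom.ker_isPrime _

/-- The symmetric algebra as an iterated polynomial ring. -/
noncomputable def iterEquiv : SymmetricAlgebra k E ≃ₐ[k] MvPolynomial τ (MvPolynomial σ k) :=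
  (SymmetricAlgebra.equivMvPolynomial b).trans (sumAlgEquiv k τ σ)

theorem iterEquiv_section (t : MvPolynomial τ k) :
    iterEquiv b (sectionInl b t) = map (algebraMap k (MvPolynomial σ k)) t := by
  have : ((iterEquiv b : SymmetricAlgebra k E →ₐ[k] _).comp (sectionInl b)) =
      mapAlgHom (Algebra.ofId k (MvPolynomial σ k)) := by
    refine algHom_ext fun i => ?_
    simp [iterEquiv, sectionInl]
  exact DFunLike.congr_fun this t

theorem iterEquiv_mem_range_C {a : SymmetricAlgebra k E}
    (ha : a ∈ Algebra.adjoin k (SymmetricAlgebra.ι k E '' (Set.range (b ∘ Sum.inr)))) :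
    ∃ r : MvPolynomial σ k, iterEquiv b a = C r := by
  have : Algebra.adjoin k (SymmetricAlgebra.ι k E '' (Set.range (b ∘ Sum.inr))) ≤
      (IsScalarTower.toAlgHom k (MvPolynomial σ k)
        (MvPolynomial τ (MvPolynomial σ k))).range.comap
        (iterEquiv b : SymmetricAlgebra k E →ₐ[k] _) := by
    refine Algebra.adjoin_le ?_
    rintro _ ⟨_, ⟨i, rfl⟩, rfl⟩
    exact ⟨X i, by simp [iterEquiv, algebraMap_eq]⟩
  obtain ⟨r, hr⟩ := this ha
  exact ⟨r, hr.symm⟩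

/-- If the ideal `𝔟` is generated by polynomials in the linear forms in `U`, and a colon ideal
`𝔟 : x` contains `U`, then it is generated by `U`. -/
theorem colon_eq_span_ι {U : Submodule k E} {A : Set (SymmetricAlgebra k E)}
    (hA : A ⊆ Algebra.adjoin k (SymmetricAlgebra.ι k E '' (U : Set E)))
    {P : Ideal (SymmetricAlgebra k E)} (hP1 : P ≠ ⊤) {x : SymmetricAlgebra k E}
    (hP : ∀ s, s ∈ P ↔ s * x ∈ Ideal.span A)
    (hU : ∀ u ∈ U, SymmetricAlgebra.ι k E u ∈ P) :
    P = Ideal.span (SymmetricAlgebra.ι k E '' (U : Set E)) := by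
  have hUP : Ideal.span (SymmetricAlgebra.ι k E '' (U : Set E)) ≤ P := by
    rw [Ideal.span_le]
    rintro _ ⟨u, hu, rfl⟩
    exact hU u hu
  refine le_antisymm (fun s hs => ?_) hUP
  obtain ⟨τ, σ, b, hb⟩ := exists_basis_sum U
  have hspan : Ideal.span (SymmetricAlgebra.ι k E '' (U : Set E)) =
      Ideal.span (SymmetricAlgebra.ι k E '' (Set.range (b ∘ Sum.inr))) := by
    rw [hb, span_ι_span]
  have hadj : Algebra.adjoin k (SymmetricAlgebra.ι k E '' (U : Set E)) ≤
      Algebra.adjoin k (SymmetricAlgebra.ι k E '' (Set.range (b ∘ Sum.inr))) := by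
    refine Algebra.adjoin_le ?_
    rw [← Submodule.map_coe, hb, Submodule.map_span]
    exact Algebra.span_le_adjoin k _
  -- Over the coefficient ring `k[σ] = Sym U`, the generators are constants, so the ideal is
  -- extended from coefficients.
  have hmap : (Ideal.span A).map (iterEquiv b) =
      (Ideal.span {r | ∃ a ∈ A, iterEquiv b a = C r}).map C := by
    rw [Ideal.map_span, Ideal.map_span]
    congr 1
    ext y
    constructor
    · rintro ⟨a, ha, rfl⟩
      obtain ⟨r, hr⟩ := iterEquiv_mem_range_C b (hadj (hA ha))
      exact ⟨r, ⟨a, ha, hr⟩, hr.symm⟩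
    · rintro ⟨r, ⟨a, ha, hr⟩, rfl⟩
      exact ⟨a, ha, hr⟩
  have hmem : ∀ s, s ∈ Ideal.span A ↔ iterEquiv b s ∈
      (Ideal.span {r | ∃ a ∈ A, iterEquiv b a = C r}).map C := by
    intro s
    rw [← hmap]
    refine ⟨fun h => Ideal.mem_map_of_mem _ h, fun h => ?_⟩
    obtain ⟨s', hs', he⟩ := (Ideal.mem_map_iff_of_surjective _ (iterEquiv b).surjective).mp h
    rwa [← (iterEquiv b).injective he]
  -- Modulo `U ⊆ P`, `s` may be replaced by a polynomial over `k` in the complementary variables; it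
  -- remains to see that this polynomial is zero.
  have hs0 : sectionInl b (killInr b s) ∈ P := by
    have h := hUP (hspan ▸ sub_section_killInr_mem b s)
    simpa using P.sub_mem hs h
  have hx : x ∉ Ideal.span A := fun h => hP1 ((Ideal.eq_top_iff_one P).mpr
    ((hP 1).mpr (by rwa [one_mul])))
  rw [hP, hmem, map_mul, iterEquiv_section] at hs0
  rw [hmem] at hx
  rw [hspan, ← ker_killInr, RingHom.mem_ker]
  exact eq_zero_of_map_mul_mem_map_C hx hs0

instance isNoetherianRing_symmetricAlgebra [FiniteDimensional k E] :
    IsNoetherianRing (SymmetricAlgebra k E) :=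
  isNoetherianRing_of_ringEquiv _
    (SymmetricAlgebra.equivMvPolynomial (Module.finBasis k E)).symm.toRingEquiv

end SymmetricAlgebra

/-! ### Closure and duality in a realized matroid -/

section Realization

variable {k : Type*} [Field k] {n : ℕ} {W : Submodule k (Fin n → k)} {M : Matroid (Fin n)}

theorem apply_eq_sum_single {ι : Type*} [Fintype ι] [DecidableEq ι] (φ : (ι → k) →ₗ[k] k)
    (w : ι → k) : φ w = ∑ i, w i * φ (Pi.single i 1) := by
  conv_lhs => rw [← Finset.univ_sum_single w]
  rw [map_sum]
  refine Finset.sum_congr rfl fun i _ => ?_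
  rw [← smul_eq_mul, ← map_smul, ← Pi.single_smul, smul_eq_mul, mul_one]

theorem perp_perp (W : Submodule k (Fin n → k)) : perp (perp W) = W := by
  refine le_antisymm (fun v hv => ?_) fun p hp q hq => ?_
  · by_contra hvW
    obtain ⟨φ, hφv, hφ⟩ := Submodule.exists_le_ker_of_notMem hvW
    have hφ' := apply_eq_sum_single φ
    refine hφv ?_
    rw [hφ']
    have : (fun i => φ (Pi.single i 1)) ∈ perp W := fun p hp => by
      rw [← hφ']
      exact hφ hp
    rw [← hv _ this]
    exact Finset.sum_congr rfl fun i _ => mul_comm _ _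
  · rw [← hq p hp]
    exact Finset.sum_congr rfl fun i _ => mul_comm _ _

/-- Restriction of the vectors in `W` to the coordinates in `B`. -/
def restrict (W : Submodule k (Fin n → k)) (B : Set (Fin n)) : W →ₗ[k] (B → k) :=
  LinearMap.funLeft k k ((↑) : B → Fin n) ∘ₗ W.subtype

theorem restrict_apply (B : Set (Fin n)) (w : W) (b : B) :
    restrict W B w b = (w : Fin n → k) b := rfl

theorem injective_restrict_iff (B : Set (Fin n)) :
    Function.Injective (restrict W B) ↔
      ∀ p ∈ W, (∀ i ∈ B, p i = 0) → p = 0 := by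
  rw [injective_iff_map_eq_zero]
  constructor
  · intro h p hp hB
    exact congrArg Subtype.val (h ⟨p, hp⟩ (funext fun b => hB b b.2))
  · intro h p hp
    exact Subtype.ext (h p p.2 fun i hi => congrFun hp ⟨i, hi⟩)

/-- A functional on `k^B` killing the image of `W`, extended by zero, is a vector of `W^⊥` supported
on `B`. -/
theorem surjective_restrict_iff (B : Set (Fin n)) :
    Function.Surjective (restrict W B) ↔ Function.Injective (restrict (perp W) Bᶜ) := by
  classical
  rw [injective_restrict_iff]
  constructor
  · intro h q hq hB
    ext j
    by_cases hj : j ∈ B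
    · obtain ⟨p, hp⟩ := h (Pi.single ⟨j, hj⟩ 1)
      have h0 := hq p p.2
      rw [Finset.sum_eq_single j] at h0
      · have : (p : Fin n → k) j = 1 := by
          rw [← restrict_apply B p ⟨j, hj⟩, hp, Pi.single_eq_same]
        rwa [this, one_mul] at h0
      · intro i _ hij
        by_cases hi : i ∈ B
        · rw [← restrict_apply B p ⟨i, hi⟩, hp, Pi.single_eq_of_ne, zero_mul]
          simpa using hij
        · rw [hB i hi, mul_zero]
      · simp
    · exact hB j hj
  · intro h
    rw [← LinearMap.range_eq_top]
    by_contra hne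
    obtain ⟨v, -, hv⟩ := SetLike.exists_of_lt (lt_top_iff_ne_top.mpr hne)
    obtain ⟨φ, hφv, hφ⟩ := Submodule.exists_le_ker_of_notMem hv
    have hφ' := apply_eq_sum_single φ
    let q : Fin n → k := fun i => if hi : i ∈ B then φ (Pi.single ⟨i, hi⟩ 1) else 0
    have hqB : ∀ i : B, q i = φ (Pi.single i 1) := fun i => by simp [q]
    have hq : q = 0 := by
      refine h q (fun p hp => ?_) fun i hi => dif_neg hi
      have h0 : φ (restrict W B ⟨p, hp⟩) = 0 := hφ (LinearMap.mem_range_self _ _)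
      rw [hφ'] at h0
      rw [← h0, ← Finset.sum_subset (Finset.subset_univ B.toFinset), ← Finset.sum_coe_sort]
      · refine Finset.sum_equiv (Equiv.subtypeEquivRight (by simp)) (by simp) fun i _ => ?_
        rw [← hqB]
        rfl
      · intro i _ hi
        rw [Set.mem_toFinset] at hi
        simp [q, hi]
    refine hφv ?_
    rw [hφ']
    refine Finset.sum_eq_zero fun i _ => ?_
    rw [← hqB, hq, Pi.zero_apply, mul_zero]

theorem Realizes.isBase_iff_bijective (hW : Realizes W M) (B : Set (Fin n)) :
    M.IsBase B ↔ Function.Bijective (restrict W B) := hW.isBase_iff B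

theorem Realizes.dual (hW : Realizes W M) : Realizes (perp W) M✶ where
  ground_eq := hW.ground_eq
  isBase_iff B := by
    change _ ↔ Function.Bijective (restrict (perp W) B)
    rw [M.dual_isBase_iff (by simp [hW.ground_eq]), hW.ground_eq, ← Set.compl_eq_univ_sdiff,
      hW.isBase_iff_bijective, Function.Bijective, Function.Bijective, surjective_restrict_iff,
      surjective_restrict_iff, perp_perp, compl_compl, and_comm]

theorem Realizes.subset_ground (hW : Realizes W M) (X : Set (Fin n)) : X ⊆ M.E := by
  simp [hW.ground_eq]

theorem Realizes.exists_coord (hW : Realizes W M) {B : Set (Fin n)} (hB : M.IsBase B)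
    {b : Fin n} (hb : b ∈ B) : ∃ p ∈ W, p b = 1 ∧ ∀ i ∈ B, i ≠ b → p i = 0 := by
  classical
  obtain ⟨p, hp⟩ := ((hW.isBase_iff_bijective B).mp hB).2 (Pi.single ⟨b, hb⟩ 1)
  refine ⟨p, p.2, ?_, fun i hi hib => ?_⟩
  · rw [← restrict_apply B p ⟨b, hb⟩, hp, Pi.single_eq_same]
  · rw [← restrict_apply B p ⟨i, hi⟩, hp, Pi.single_eq_of_ne]
    simpa using hib

theorem Realizes.eq_zero_of_isBase (hW : Realizes W M) {B : Set (Fin n)} (hB : M.IsBase B)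
    {p : Fin n → k} (hp : p ∈ W) (h : ∀ i ∈ B, p i = 0) : p = 0 :=
  (injective_restrict_iff B).mp ((hW.isBase_iff_bijective B).mp hB).1 p hp h

/-- Independence of `insert i I` can be certified by a vector vanishing on `I` but not at `i`. -/
theorem Realizes.insert_indep (hW : Realizes W M) {I : Set (Fin n)} (hI : M.Indep I) {i : Fin n}
    {p : Fin n → k} (hp : p ∈ W) (hpI : ∀ j ∈ I, p j = 0) (hpi : p i ≠ 0) :
    M.Indep (insert i I) := by
  classical
  obtain ⟨B, hB, hIB⟩ := hI.exists_isBase_superset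
  by_cases hiB : i ∈ B
  · exact hB.indep.subset (Set.insert_subset hiB hIB)
  -- `d` is the basis of `W` dual to the coordinates in `B`. Since `p` vanishes on `I` but not at
  -- `i`, some `b ∈ B \ I` has `d b i ≠ 0` and can be exchanged for `i`.
  choose! d hdW hd1 hd0 using fun b (hb : b ∈ B) => hW.exists_coord hB hb
  have hsum : ∀ w ∈ W, w = ∑ b ∈ B.toFinset, w b • d b := by
    intro w hw
    rw [← sub_eq_zero]
    refine hW.eq_zero_of_isBase hB (W.sub_mem hw (W.sum_mem fun b hb =>
      W.smul_mem _ (hdW b (Set.mem_toFinset.mp hb)))) fun j hj => ?_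
    rw [Pi.sub_apply, Finset.sum_apply, Finset.sum_eq_single j, Pi.smul_apply, hd1 j hj]
    · simp
    · intro b hb hbj
      rw [Pi.smul_apply, hd0 b (Set.mem_toFinset.mp hb) j hj hbj.symm, smul_zero]
    · simp [hj]
  obtain ⟨b, hbB, hb⟩ : ∃ b ∈ B, p b * d b i ≠ 0 := by
    by_contra! hcon
    refine hpi ?_
    rw [hsum p hp, Finset.sum_apply]
    exact Finset.sum_eq_zero fun b hb => hcon b (Set.mem_toFinset.mp hb)
  have hbI : b ∉ I := fun h => hb (by rw [hpI b h, zero_mul])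
  have hB' : M.IsBase (insert i (B \ {b})) := by
    rw [hW.isBase_iff_bijective]
    have hinj : Function.Injective (restrict W (insert i (B \ {b}))) := by
      rw [injective_restrict_iff]
      intro w hw h
      have hwi := h i (Set.mem_insert _ _)
      have hwB : ∀ j ∈ B, j ≠ b → w j = 0 := fun j hj hjb =>
        h j (Set.mem_insert_of_mem _ ⟨hj, hjb⟩)
      refine hW.eq_zero_of_isBase hB hw fun j hj => ?_
      by_cases hjb : j = b
      · subst hjb
        rw [hsum w hw, Finset.sum_apply, Finset.sum_eq_single j] at hwi
        · exact (mul_eq_zero.mp hwi).resolve_right (right_ne_zero_of_mul hb)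
        · intro c hc hcj
          rw [Pi.smul_apply, hwB c (Set.mem_toFinset.mp hc) hcj, zero_smul]
        · simp [hj]
      · exact hwB j hj hjb
    refine ⟨hinj, ?_⟩
    have hcard : Module.finrank k W = Fintype.card B := by
      rw [(LinearEquiv.ofBijective _ ((hW.isBase_iff_bijective B).mp hB)).finrank_eq,
        Module.finrank_fintype_fun_eq_card]
    refine (LinearMap.injective_iff_surjective_of_finrank_eq_finrank ?_).mp hinj
    rw [hcard, Module.finrank_fintype_fun_eq_card, ← Set.toFinset_card, ← Set.toFinset_card,
      Set.toFinset_insert, Finset.card_insert_of_notMem (by simp [hiB]), Set.toFinset_sdiff,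
      Set.toFinset_singleton, Finset.sdiff_singleton_eq_erase, Finset.card_erase_add_one]
    simpa using hbB
  exact hB'.indep.subset (Set.insert_subset_insert (Set.subset_sdiff_singleton hIB hbI))

/-- A vector vanishing on a basis `I` of `X` but not at `i` certifies that `insert i I` is
independent; conversely, if that set is independent, a dual basis vector of a base containing it is
such a vector. -/
theorem Realizes.mem_closure_iff (hW : Realizes W M) {X : Set (Fin n)} {i : Fin n} :
    i ∈ M.closure X ↔ ∀ p ∈ W, (∀ j ∈ X, p j = 0) → p i = 0 := by
  obtain ⟨I, hI⟩ := M.exists_isBasis X (hW.subset_ground X)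
  have key : ∀ {i}, i ∈ M.closure X → ∀ p ∈ W, (∀ j ∈ I, p j = 0) → p i = 0 := by
    intro i hi p hp hpI
    rw [← hI.closure_eq_closure] at hi
    by_contra hpi
    have hiI : i ∉ I := fun h => hpi (hpI i h)
    exact ((hI.indep.mem_closure_iff_of_notMem hiI).mp hi).not_indep
      (hW.insert_indep hI.indep hp hpI hpi)
  refine ⟨fun hi p hp hpX => key hi p hp fun j hj => hpX j (hI.subset hj), fun h => ?_⟩
  by_contra hi
  have hi' : i ∉ M.closure I := by rwa [hI.closure_eq_closure]
  have hiI : i ∉ I := fun h => hi' (M.mem_closure_of_mem h (hW.subset_ground I))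
  obtain ⟨B, hB, hIB⟩ := ((hI.indep.notMem_closure_iff_of_notMem hiI
    (hW.subset_ground _ (Set.mem_singleton i))).mp hi').exists_isBase_superset
  obtain ⟨p, hp, hpi, hpB⟩ := hW.exists_coord hB (hIB (Set.mem_insert i I))
  have hpI : ∀ j ∈ I, p j = 0 := fun j hj =>
    hpB j (hIB (Set.mem_insert_of_mem i hj)) (ne_of_mem_of_not_mem hj hiI)
  have := h p hp fun j hj => key (M.mem_closure_of_mem hj (hW.subset_ground X)) p hp hpI
  rw [hpi] at this
  exact one_ne_zero this

/-- For `p ∈ W` vanishing on `X` and `q ∈ W^⊥` vanishing on `Y`, the pairing reduces to `p e * q e =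
0`. -/
theorem Realizes.mem_closure_dual_of_notMem (hW : Realizes W M) {X Y : Set (Fin n)} {e : Fin n}
    (hXY : insert e (X ∪ Y) = Set.univ) (he : e ∉ M.closure X) : e ∈ M✶.closure Y := by
  rw [hW.dual.mem_closure_iff]
  intro q hq hqY
  rw [hW.mem_closure_iff] at he
  push Not at he
  obtain ⟨p, hp, hpX, hpe⟩ := he
  have h0 := hq p hp
  rw [Finset.sum_eq_single e] at h0
  · exact (mul_eq_zero.mp h0).resolve_left hpe
  · intro i _ hie
    obtain h | h | h : i = e ∨ i ∈ X ∨ i ∈ Y := by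
      simpa using hXY.ge (Set.mem_univ i)
    · exact absurd h hie
    · rw [hpX i h, zero_mul]
    · rw [hqY i h, mul_zero]
  · simp

/-- A relation expressing coordinate `e` on `W` through those in `X` is a vector of `W^⊥` supported
on `insert e X`, with value 1 at `e` and 0 on `Y`. -/
theorem Realizes.notMem_closure_dual (hW : Realizes W M) {X Y : Set (Fin n)} {e : Fin n}
    (heX : e ∉ X) (hXY : Disjoint X Y) (heY : e ∉ Y) (he : e ∈ M.closure X) :
    e ∉ M✶.closure Y := by
  classical
  intro heY'
  rw [hW.mem_closure_iff] at he
  rw [hW.dual.mem_closure_iff] at heY'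
  have hspan : LinearMap.proj e ∘ₗ W.subtype ∈ Submodule.span k
      (Set.range fun j : X => (LinearMap.proj (j : Fin n) ∘ₗ W.subtype : W →ₗ[k] k)) := by
    refine FiniteDimensional.mem_span_of_iInf_ker_le_ker fun w hw => ?_
    refine he w w.2 fun j hj => ?_
    exact (Submodule.mem_iInf _).mp hw ⟨j, hj⟩
  obtain ⟨c, hc⟩ := (Submodule.mem_span_range_iff_exists_fun k).mp hspan
  have := heY' (Pi.single e 1 - ∑ j : X, c j • Pi.single (j : Fin n) 1) (fun p hp => ?_)
    fun j hj => ?_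
  · rw [Pi.sub_apply, Finset.sum_apply, Pi.single_eq_same, Finset.sum_eq_zero, sub_zero] at this
    · exact one_ne_zero this
    · intro j _
      rw [Pi.smul_apply, Pi.single_eq_of_ne (ne_of_mem_of_not_mem j.2 heX).symm, smul_zero]
  · have h := DFunLike.congr_fun hc ⟨p, hp⟩
    simp only [LinearMap.sum_apply, LinearMap.smul_apply, LinearMap.comp_apply,
      Submodule.subtype_apply, LinearMap.proj_apply, smul_eq_mul] at h
    simp only [Pi.sub_apply, Finset.sum_apply, Pi.smul_apply, mul_sub, Finset.sum_sub_distrib,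
      Finset.mul_sum, smul_eq_mul]
    rw [Finset.sum_comm]
    simp [Pi.single_apply, ← h, mul_comm]
  · rw [Pi.sub_apply, Finset.sum_apply, Pi.single_eq_of_ne (ne_of_mem_of_not_mem hj heY),
      Finset.sum_eq_zero, sub_zero]
    intro i _
    rw [Pi.smul_apply, Pi.single_eq_of_ne (hXY.ne_of_mem i.2 hj).symm, smul_zero]

/-- A flat is cyclic if and only if its complement is a flat of the dual matroid. -/
theorem Realizes.isCyclicFlat_iff (hW : Realizes W M) {F : Set (Fin n)} :
    IsCyclicFlat M F ↔ M.IsFlat F ∧ M✶.IsFlat Fᶜ := by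
  constructor
  · rintro ⟨hF, 𝒞, h𝒞, rfl⟩
    refine ⟨hF, ?_⟩
    rw [Matroid.isFlat_iff_closure_eq]
    refine Set.Subset.antisymm (fun e he => ?_) (Matroid.subset_closure _ _ (hW.subset_ground _))
    rintro ⟨C, hC, heC⟩
    refine hW.notMem_closure_dual (X := C \ {e}) (by simp) ?_ (by simpa using ⟨C, hC, heC⟩)
      ((h𝒞 C hC).mem_closure_sdiff_singleton_of_mem heC) he
    exact Set.disjoint_compl_right_iff_subset.mpr
      (Set.sdiff_subset.trans (Set.subset_sUnion_of_mem hC))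
  · rintro ⟨hF, hG⟩
    refine ⟨hF, {C | M.IsCircuit C ∧ C ⊆ F}, fun C hC => hC.1, ?_⟩
    refine Set.Subset.antisymm (fun e he => ?_) (Set.sUnion_subset fun C hC => hC.2)
    -- Otherwise `e` would lie in the dual closure of `Fᶜ`, which is `Fᶜ` itself.
    have he' : e ∈ M.closure (F \ {e}) := by
      by_contra hcon
      refine (hG.closure.le (hW.mem_closure_dual_of_notMem (Y := Fᶜ) ?_ hcon)) he
      rw [← Set.insert_union, Set.insert_sdiff_singleton, Set.insert_eq_of_mem he,
        Set.union_compl_self]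
    obtain ⟨C, hCF, hC, heC⟩ := Matroid.exists_isCircuit_of_mem_closure he' (by simp)
    rw [Set.insert_sdiff_singleton, Set.insert_eq_of_mem he] at hCF
    exact ⟨C, ⟨hC, hCF⟩, heC⟩

end Realization

/-! ### Primes and primary components of the ideal of pairs -/

section Ideals

variable {k : Type*} [Field k] {n : ℕ} {W : Submodule k (Fin n → k)} {M : Matroid (Fin n)}

theorem linIdeal_eq_span_ι (W : Submodule k (Fin n → k)) (I J : Set (Fin n)) :
    linIdeal W I J =
      Ideal.span (SymmetricAlgebra.ι k _ '' (fstCoord W '' I ∪ sndCoord W '' J)) := by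
  rw [linIdeal, Set.image_union, Ideal.span_union, Set.image_image, Set.image_image]
  rfl

theorem isPrime_linIdeal (W : Submodule k (Fin n → k)) (I J : Set (Fin n)) :
    (linIdeal W I J).IsPrime := by
  rw [linIdeal_eq_span_ι]
  exact isPrime_span_ι _

theorem linIdeal_le_iff {I J : Set (Fin n)} {P : Ideal (CoordRing W)} :
    linIdeal W I J ≤ P ↔ (∀ i ∈ I, f W i ∈ P) ∧ ∀ j ∈ J, g W j ∈ P := by
  rw [linIdeal, sup_le_iff, Ideal.span_le, Ideal.span_le, Set.image_subset_iff,
    Set.image_subset_iff]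
  rfl

theorem f_mem_linIdeal {I J : Set (Fin n)} {i : Fin n} (hi : i ∈ I) : f W i ∈ linIdeal W I J :=
  (linIdeal_le_iff.mp le_rfl).1 i hi

theorem g_mem_linIdeal {I J : Set (Fin n)} {j : Fin n} (hj : j ∈ J) : g W j ∈ linIdeal W I J :=
  (linIdeal_le_iff.mp le_rfl).2 j hj

theorem pairs_le_linIdeal {I J : Set (Fin n)} (h : I ∪ J = Set.univ) :
    pairs W ≤ linIdeal W I J := by
  rw [pairs, Ideal.span_le]
  rintro _ ⟨i, rfl⟩
  obtain hi | hi := h.ge (Set.mem_univ i)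
  · exact Ideal.mul_mem_right _ _ (f_mem_linIdeal hi)
  · exact Ideal.mul_mem_left _ _ (g_mem_linIdeal hi)

theorem mul_mem_pairs (W : Submodule k (Fin n → k)) (i : Fin n) : f W i * g W i ∈ pairs W :=
  Ideal.subset_span ⟨i, rfl⟩

theorem ι_mem_of_mem_span {E : Type*} [AddCommGroup E] [Module k E]
    {P : Ideal (SymmetricAlgebra k E)} {A : Set E} (hA : ∀ a ∈ A, SymmetricAlgebra.ι k E a ∈ P)
    {u : E} (hu : u ∈ Submodule.span k A) : SymmetricAlgebra.ι k E u ∈ P := by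
  have : Submodule.span k A ≤ (P.restrictScalars k).comap (SymmetricAlgebra.ι k E) :=
    Submodule.span_le.mpr hA
  exact this hu

theorem Realizes.f_mem_of_mem_closure (hW : Realizes W M) {P : Ideal (CoordRing W)}
    {I : Set (Fin n)} (h : ∀ j ∈ I, f W j ∈ P) {i : Fin n} (hi : i ∈ M.closure I) :
    f W i ∈ P := by
  refine ι_mem_of_mem_span (A := Set.range fun j : I => fstCoord W j) ?_
    (FiniteDimensional.mem_span_of_iInf_ker_le_ker fun x hx => ?_)
  · rintro _ ⟨j, rfl⟩
    exact h j j.2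
  · exact hW.mem_closure_iff.mp hi x.1 x.1.2 fun j hj => (Submodule.mem_iInf _).mp hx ⟨j, hj⟩

theorem Realizes.g_mem_of_mem_closure (hW : Realizes W M) {P : Ideal (CoordRing W)}
    {J : Set (Fin n)} (h : ∀ j ∈ J, g W j ∈ P) {i : Fin n} (hi : i ∈ M✶.closure J) :
    g W i ∈ P := by
  refine ι_mem_of_mem_span (A := Set.range fun j : J => sndCoord W j) ?_
    (FiniteDimensional.mem_span_of_iInf_ker_le_ker fun x hx => ?_)
  · rintro _ ⟨j, rfl⟩
    exact h j j.2
  · exact hW.dual.mem_closure_iff.mp hi x.2 x.2.2 fun j hj =>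
      (Submodule.mem_iInf _).mp hx ⟨j, hj⟩

theorem mem_pointLocus_linIdeal {I J : Set (Fin n)} {x : W × perp W} :
    x ∈ pointLocus W (linIdeal W I J) ↔
      (∀ i ∈ I, (x.1 : Fin n → k) i = 0) ∧ ∀ j ∈ J, (x.2 : Fin n → k) j = 0 := by
  rw [pointLocus_linIdeal]
  simp [linSubspace, fstCoord, sndCoord]

/-- Evaluation at points `(p, 0)` makes `J` irrelevant. -/
theorem Realizes.f_mem_linIdeal_iff (hW : Realizes W M) {I J : Set (Fin n)} {i : Fin n} :
    f W i ∈ linIdeal W I J ↔ i ∈ M.closure I := by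
  refine ⟨fun h => hW.mem_closure_iff.mpr fun p hp hpI => ?_,
    hW.f_mem_of_mem_closure fun j hj => f_mem_linIdeal hj⟩
  have hx : ((⟨p, hp⟩, 0) : W × perp W) ∈ pointLocus W (linIdeal W I J) :=
    mem_pointLocus_linIdeal.mpr ⟨hpI, fun _ _ => rfl⟩
  simpa [f, evalAt, fstCoord] using hx _ h

theorem Realizes.g_mem_linIdeal_iff (hW : Realizes W M) {I J : Set (Fin n)} {j : Fin n} :
    g W j ∈ linIdeal W I J ↔ j ∈ M✶.closure J := by
  refine ⟨fun h => hW.dual.mem_closure_iff.mpr fun q hq hqJ => ?_,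
    hW.g_mem_of_mem_closure fun j hj => g_mem_linIdeal hj⟩
  have hx : ((0, ⟨q, hq⟩) : W × perp W) ∈ pointLocus W (linIdeal W I J) :=
    mem_pointLocus_linIdeal.mpr ⟨fun _ _ => rfl, hqJ⟩
  simpa [g, evalAt, sndCoord] using hx _ h

theorem Realizes.isFlat_setOf_f_mem (hW : Realizes W M) (P : Ideal (CoordRing W)) :
    M.IsFlat {i | f W i ∈ P} :=
  Matroid.isFlat_iff_closure_eq.mpr (Set.Subset.antisymm
    (fun _ hi => hW.f_mem_of_mem_closure (fun _ hj => hj) hi)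
    (M.subset_closure _ (hW.subset_ground _)))

theorem Realizes.isFlat_setOf_g_mem (hW : Realizes W M) (P : Ideal (CoordRing W)) :
    M✶.IsFlat {i | g W i ∈ P} :=
  Matroid.isFlat_iff_closure_eq.mpr (Set.Subset.antisymm
    (fun _ hi => hW.g_mem_of_mem_closure (fun _ hj => hj) hi)
    (M✶.subset_closure _ (hW.subset_ground _)))

theorem setOf_f_mem_union_setOf_g_mem {P : Ideal (CoordRing W)} [P.IsPrime] (h : pairs W ≤ P) :
    {i | f W i ∈ P} ∪ {i | g W i ∈ P} = Set.univ :=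
  Set.eq_univ_of_forall fun i => Ideal.IsPrime.mem_or_mem ‹_› (h (mul_mem_pairs W i))

/-- Generators of the ideal of pairs after localizing at a prime containing exactly the `f i` with
`i ∈ I` and the `g j` with `j ∈ J`. -/
def localGens (W : Submodule k (Fin n → k)) (I J : Set (Fin n)) : Set (CoordRing W) :=
  f W '' Jᶜ ∪ g W '' Iᶜ ∪ (fun i => f W i * g W i) '' (I ∩ J)

theorem pairs_le_span_localGens (W : Submodule k (Fin n → k)) (I J : Set (Fin n)) :
    pairs W ≤ Ideal.span (localGens W I J) := by
  rw [pairs, Ideal.span_le]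
  rintro _ ⟨i, rfl⟩
  by_cases hJ : i ∈ J
  · by_cases hI : i ∈ I
    · exact Ideal.subset_span (Or.inr ⟨i, ⟨hI, hJ⟩, rfl⟩)
    · exact Ideal.mul_mem_left _ _ (Ideal.subset_span (Or.inl (Or.inr ⟨i, hI, rfl⟩)))
  · exact Ideal.mul_mem_right _ _ (Ideal.subset_span (Or.inl (Or.inl ⟨i, hJ, rfl⟩)))

/-- Localization at `P` in denominator-free form: `h` is the product of all `f i` and `g i` outside
`P`. -/
theorem exists_notMem_mul_mem_pairs (P : Ideal (CoordRing W)) [P.IsPrime] :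
    ∃ h ∉ P, ∀ s ∈ Ideal.span (localGens W {i | f W i ∈ P} {i | g W i ∈ P}),
      h * s ∈ pairs W := by
  classical
  let h₁ := ∏ i with f W i ∉ P, f W i
  let h₂ := ∏ i with g W i ∉ P, g W i
  refine ⟨h₁ * h₂, ?_, ?_⟩
  · rw [Ideal.IsPrime.mul_mem_iff_mem_or_mem, not_or, Ideal.IsPrime.prod_mem_iff,
      Ideal.IsPrime.prod_mem_iff]
    · simp
    · infer_instance
  · suffices key : ∀ a ∈ localGens W {i | f W i ∈ P} {i | g W i ∈ P},
        h₁ * h₂ * a ∈ pairs W by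
      have hle : Ideal.span (localGens W {i | f W i ∈ P} {i | g W i ∈ P}) ≤
          Submodule.comap (LinearMap.mulLeft (CoordRing W) (h₁ * h₂)) (pairs W) :=
        Ideal.span_le.mpr key
      exact fun s hs => hle hs
    rintro _ ((⟨i, hi, rfl⟩ | ⟨i, hi, rfl⟩) | ⟨i, -, rfl⟩)
    · obtain ⟨c, hc⟩ : g W i ∣ h₂ := Finset.dvd_prod_of_mem _ (by simpa using hi)
      have : h₁ * h₂ * f W i = h₁ * c * (f W i * g W i) := by rw [hc]; ring
      exact this ▸ Ideal.mul_mem_left _ _ (mul_mem_pairs W i)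
    · obtain ⟨c, hc⟩ : f W i ∣ h₁ := Finset.dvd_prod_of_mem _ (by simpa using hi)
      have : h₁ * h₂ * g W i = c * h₂ * (f W i * g W i) := by rw [hc]; ring
      exact this ▸ Ideal.mul_mem_left _ _ (mul_mem_pairs W i)
    · exact Ideal.mul_mem_left _ _ (mul_mem_pairs W i)

theorem eq_linIdeal_of_mem_associatedPrimes {P : Ideal (CoordRing W)}
    (hP : P ∈ associatedPrimes (CoordRing W) (CoordRing W ⧸ pairs W)) :
    pairs W ≤ P ∧ P = linIdeal W {i | f W i ∈ P} {i | g W i ∈ P} := by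
  obtain ⟨hprime, x, hx⟩ := isAssociatedPrime_iff.mp hP
  obtain ⟨y, rfl⟩ := Ideal.Quotient.mk_surjective x
  have hmem : ∀ s, s ∈ P ↔ s * y ∈ pairs W := by
    intro s
    conv_lhs => rw [hx]
    rw [Submodule.mem_colon_singleton, Submodule.mem_bot, ← Ideal.Quotient.eq_zero_iff_mem]
    rfl
  have hle : pairs W ≤ P := fun s hs => (hmem s).mpr (Ideal.mul_mem_right _ _ hs)
  refine ⟨hle, ?_⟩
  obtain ⟨h, hh, hmul⟩ := exists_notMem_mul_mem_pairs P
  have hunion := setOf_f_mem_union_setOf_g_mem hle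
  set I := {i | f W i ∈ P}
  set J := {i | g W i ∈ P}
  have hf : ∀ i ∈ I, f W i ∈ Algebra.adjoin k (SymmetricAlgebra.ι k _ ''
      (Submodule.span k (fstCoord W '' I ∪ sndCoord W '' J) :
        Set (Module.Dual k (W × perp W)))) := fun i hi =>
    Algebra.subset_adjoin ⟨_, Submodule.subset_span (Or.inl ⟨i, hi, rfl⟩), rfl⟩
  have hg : ∀ i ∈ J, g W i ∈ Algebra.adjoin k (SymmetricAlgebra.ι k _ ''
      (Submodule.span k (fstCoord W '' I ∪ sndCoord W '' J) :
        Set (Module.Dual k (W × perp W)))) := fun i hi =>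
    Algebra.subset_adjoin ⟨_, Submodule.subset_span (Or.inr ⟨i, hi, rfl⟩), rfl⟩
  rw [linIdeal_eq_span_ι, ← span_ι_span]
  refine colon_eq_span_ι (A := localGens W I J) (x := y) ?_ hprime.ne_top (fun s => ?_) ?_
  · rintro _ ((⟨i, hi, rfl⟩ | ⟨i, hi, rfl⟩) | ⟨i, ⟨hI, hJ⟩, rfl⟩)
    · exact hf i ((hunion.ge (Set.mem_univ i)).resolve_right hi)
    · exact hg i ((hunion.ge (Set.mem_univ i)).resolve_left hi)
    · exact mul_mem (hf i hI) (hg i hJ)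
  -- Since `h ∉ P`, the colon by `y` is the same for `pairs W` and for the ideal of local
  -- generators.
  · rw [hmem]
    refine ⟨fun hs => pairs_le_span_localGens W I J hs, fun hs => ?_⟩
    rw [← hmem]
    refine (hprime.mem_or_mem ((hmem (h * s)).mpr ?_)).resolve_left hh
    rw [mul_assoc]
    exact hmul _ hs
  · refine fun u hu => ι_mem_of_mem_span ?_ hu
    rintro _ (⟨i, hi, rfl⟩ | ⟨i, hi, rfl⟩)
    · exact hi
    · exact hi

theorem Realizes.exists_isBiflat (hW : Realizes W M) {P : Ideal (CoordRing W)}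
    (hP : P ∈ associatedPrimes (CoordRing W) (CoordRing W ⧸ pairs W)) :
    ∃ F G : Set (Fin n), IsBiflat M F G ∧ P = linIdeal W F G := by
  obtain ⟨hle, heq⟩ := eq_linIdeal_of_mem_associatedPrimes hP
  have := hP.isPrime
  exact ⟨_, _, ⟨hW.isFlat_setOf_f_mem P, hW.isFlat_setOf_g_mem P,
    setOf_f_mem_union_setOf_g_mem hle⟩, heq⟩

theorem Realizes.exists_isCyclicFlat (hW : Realizes W M) {P : Ideal (CoordRing W)}
    (hP : P ∈ (pairs W).minimalPrimes) : ∃ F, IsCyclicFlat M F ∧ P = linIdeal W F Fᶜ := by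
  have hprime : P.IsPrime := hP.1.1
  have hunion := setOf_f_mem_union_setOf_g_mem hP.1.2
  have hflatI := hW.isFlat_setOf_f_mem P
  have hflatJ := hW.isFlat_setOf_g_mem P
  have heq : ∀ {I J}, I ∪ J = Set.univ → I ⊆ {i | f W i ∈ P} → J ⊆ {i | g W i ∈ P} →
      P = linIdeal W I J := by
    intro I J h hI hJ
    have hle : linIdeal W I J ≤ P := linIdeal_le_iff.mpr ⟨hI, hJ⟩
    exact le_antisymm (hP.2 ⟨isPrime_linIdeal W I J, pairs_le_linIdeal h⟩ hle) hle
  have hJI : {i | g W i ∈ P}ᶜ ⊆ {i | f W i ∈ P} := Set.compl_subset_iff_union.mpr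
    (by rwa [Set.union_comm])
  have hIJ : {i | f W i ∈ P}ᶜ ⊆ {i | g W i ∈ P} := Set.compl_subset_iff_union.mpr hunion
  have h₁ := heq (Set.compl_union_self _) hJI subset_rfl
  have h₂ := heq (Set.union_compl_self _) subset_rfl hIJ
  have hcompl : {i | f W i ∈ P}ᶜ = {i | g W i ∈ P} := by
    refine Set.Subset.antisymm hIJ fun e heJ heI => ?_
    have he₁ : e ∈ M.closure {i | g W i ∈ P}ᶜ := by
      rw [← hW.f_mem_linIdeal_iff (J := {i | g W i ∈ P}), ← h₁]
      exact heI
    have he₂ : e ∈ M✶.closure {i | f W i ∈ P}ᶜ := by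
      rw [← hW.g_mem_linIdeal_iff (I := {i | f W i ∈ P}), ← h₂]
      exact heJ
    exact hW.notMem_closure_dual (not_not.mpr heJ)
      (Set.disjoint_compl_right_iff_subset.mpr hJI) (not_not.mpr heI) he₁ he₂
  exact ⟨_, hW.isCyclicFlat_iff.mpr ⟨hflatI, hcompl ▸ hflatJ⟩, h₂⟩

/-- A minimal prime below has the form `p_{F', F'ᶜ}`; flatness of `F` and `Fᶜ` gives `F' ⊆ F` and
`F'ᶜ ⊆ Fᶜ`, hence equality. -/
theorem Realizes.linIdeal_mem_minimalPrimes (hW : Realizes W M) {F : Set (Fin n)}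
    (hF : IsCyclicFlat M F) : linIdeal W F Fᶜ ∈ (pairs W).minimalPrimes := by
  have := isPrime_linIdeal W F Fᶜ
  obtain ⟨P, hP, hle⟩ := Ideal.exists_minimalPrimes_le
    (pairs_le_linIdeal (W := W) (Set.union_compl_self F))
  obtain ⟨F', -, rfl⟩ := hW.exists_isCyclicFlat hP
  obtain ⟨hflat, hflat'⟩ := hW.isCyclicFlat_iff.mp hF
  obtain ⟨h₁, h₂⟩ := linIdeal_le_iff.mp hle
  have hFF' : F' = F := by
    refine Set.Subset.antisymm (fun i hi => ?_) (Set.compl_subset_compl.mp fun i hi => ?_)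
    · exact hflat.closure.le (hW.f_mem_linIdeal_iff.mp (h₁ i hi))
    · exact hflat'.closure.le (hW.g_mem_linIdeal_iff.mp (h₂ i hi))
  rwa [hFF'] at hP

theorem Realizes.minimalPrimes_pairs (hW : Realizes W M) :
    (pairs W).minimalPrimes = {P | ∃ F, IsCyclicFlat M F ∧ P = linIdeal W F Fᶜ} := by
  refine Set.Subset.antisymm (fun P hP => hW.exists_isCyclicFlat hP) ?_
  rintro _ ⟨F, hF, rfl⟩
  exact hW.linIdeal_mem_minimalPrimes hF

theorem Realizes.pairs_le_iff (hW : Realizes W M) {P : Ideal (CoordRing W)} [P.IsPrime] :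
    pairs W ≤ P ↔ ∃ F, IsCyclicFlat M F ∧ linIdeal W F Fᶜ ≤ P := by
  constructor
  · intro h
    obtain ⟨Q, hQ, hle⟩ := Ideal.exists_minimalPrimes_le h
    obtain ⟨F, hF, rfl⟩ := hW.exists_isCyclicFlat hQ
    exact ⟨F, hF, hle⟩
  · rintro ⟨F, -, h⟩
    exact (pairs_le_linIdeal (Set.union_compl_self F)).trans h

/-- A primary ideal over the ideal of pairs whose radical is `p_{F, F^c}` is `p_{F, F^c}`. -/
theorem Realizes.eq_linIdeal_of_isPrimary (hW : Realizes W M) {F : Set (Fin n)}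
    (hF : IsCyclicFlat M F) {Q : Ideal (CoordRing W)} (hQ : Q.IsPrimary) (hle : pairs W ≤ Q)
    (hrad : Q.radical = linIdeal W F Fᶜ) : Q = linIdeal W F Fᶜ := by
  refine le_antisymm (hrad ▸ Ideal.le_radical) ?_
  have := isPrime_linIdeal W F Fᶜ
  obtain ⟨hflat, hflat'⟩ := hW.isCyclicFlat_iff.mp hF
  obtain ⟨h, hh, hmul⟩ := exists_notMem_mul_mem_pairs (linIdeal W F Fᶜ)
  -- `h * s ∈ Q` with `h` outside the radical forces `s ∈ Q`.
  have key : ∀ s ∈ localGens W {i | f W i ∈ linIdeal W F Fᶜ} {i | g W i ∈ linIdeal W F Fᶜ},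
      s ∈ Q := by
    intro s hs
    have hsQ := hle (hmul s (Ideal.subset_span hs))
    rw [mul_comm] at hsQ
    exact ((Ideal.isPrimary_iff.mp hQ).2 hsQ).resolve_right (hrad ▸ hh)
  rw [linIdeal_le_iff]
  refine ⟨fun i hi => key _ (Or.inl (Or.inl ⟨i, fun hcon => ?_, rfl⟩)),
    fun i hi => key _ (Or.inl (Or.inr ⟨i, fun hcon => ?_, rfl⟩))⟩
  · exact hflat'.closure.le (hW.g_mem_linIdeal_iff.mp hcon) hi
  · exact hi (hflat.closure.le (hW.f_mem_linIdeal_iff.mp hcon))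

end Ideals

end IdealOfPairs

open IdealOfPairs in
theorem theorem3p5 {k : Type*} [Field k] {n : ℕ} (M : Matroid (Fin n))
    (W : Submodule k (Fin n → k)) (hW : Realizes W M) :
    -- (a) associated primes
    (∀ P ∈ associatedPrimes (CoordRing W) (CoordRing W ⧸ pairs W),
      ∃ F G : Set (Fin n), IsBiflat M F G ∧ P = linIdeal W F G) ∧
    -- (b) minimal primes, and the variety as a scheme-theoretic support and on `k`-points
    (pairs W).minimalPrimes = {P | ∃ F, IsCyclicFlat M F ∧ P = linIdeal W F Fᶜ} ∧
    PrimeSpectrum.zeroLocus (pairs W : Set (CoordRing W)) =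
      ⋃ F ∈ {F | IsCyclicFlat M F},
        PrimeSpectrum.zeroLocus (linIdeal W F Fᶜ : Set (CoordRing W)) ∧
    pointLocus W (pairs W) =
      ⋃ F ∈ {F | IsCyclicFlat M F}, (linSubspace W F Fᶜ : Set (W × perp W)) ∧
    -- (c) primary components at the minimal primes
    (∃ t : Finset (Ideal (CoordRing W)),
      Submodule.IsMinimalPrimaryDecomposition (pairs W) t) ∧
    (∀ F, IsCyclicFlat M F → ∀ t : Finset (Ideal (CoordRing W)),
      Submodule.IsMinimalPrimaryDecomposition (pairs W) t →
        linIdeal W F Fᶜ ∈ t ∧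
          ∀ Q ∈ t, Q.radical = linIdeal W F Fᶜ → Q = linIdeal W F Fᶜ) := by
  refine ⟨fun P hP => hW.exists_isBiflat hP, hW.minimalPrimes_pairs, ?_, ?_, ?_, ?_⟩
  · ext P
    simp only [Set.mem_iUnion, PrimeSpectrum.mem_zeroLocus, SetLike.coe_subset_coe, exists_prop]
    exact hW.pairs_le_iff
  · ext x
    -- A `k`-point is treated as the prime kernel of its evaluation map.
    have := RingHom.ker_isPrime (evalAt W x)
    simp only [Set.mem_iUnion, exists_prop, ← pointLocus_linIdeal]
    exact hW.pairs_le_iff (P := RingHom.ker (evalAt W x))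
  · exact Submodule.IsLasker.exists_isMinimalPrimaryDecomposition
      (Submodule.isLasker (CoordRing W) (CoordRing W)) (pairs W)
  · intro F hF t ht
    have key : ∀ Q ∈ t, Q.radical = linIdeal W F Fᶜ → Q = linIdeal W F Fᶜ := fun Q hQ hrad =>
      hW.eq_linIdeal_of_isPrimary hF (ht.primary hQ)
        (ht.inf_eq.symm.trans_le (Finset.inf_le hQ)) hrad
    refine ⟨?_, key⟩
    obtain ⟨Q, hQ, hrad⟩ := Ideal.IsMinimalPrimaryDecomposition.minimalPrimes_subset_image_radical
      ht (hW.linIdeal_mem_minimalPrimes hF)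
    exact key Q hQ hrad ▸ hQ
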